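/- Let $N$ be a simply connected Lie group whose Lie algebra $\mathfrak{N}$ is finite-dimensional, real and 2-step nilpotent, that is, $[[X,Y],W]=0$ for all $X,Y,W\in\mathfrak{N}$ but $\mathfrak{N}$ is not abelian. Let $\langle\,,\rangle$ be a left invariant Riemannian metric on $N$ with Levi-Civita connection $\nabla$ and curvature tensor $R(X,Y)W=\nabla_X\nabla_YW-\nabla_Y\nabla_XW-\nabla_{[X,Y]}W$. Let $\mathfrak{Z}$ be the center of $\mathfrak{N}$ and $\mathfrak{V}=\mathfrak{Z}^\perp$. For $Z\in[\mathfrak{N},\mathfrak{N}]$ let $j(Z):\mathfrak{V}\to\mathfrak{V}$ be the skew symmetric map with $\langle j(Z)X,Y\rangle=\langle[X,Y],Z\rangle$ for all $X,Y\in\mathfrak{V}$, let $R_Z(X)=R(X,Z)Z$, and let $\gamma(t)=\exp(tZ)$. Elements of $\mathfrak{N}$ are identified with left invariant vector fields on $N$, and $Y'$ denotes the covariant derivative of a vector field $Y$ along $\gamma$; $Y$ is a Jacobi field if it is smooth and $Y''+R(Y,\gamma')\gamma'=0$. Let $\{A_1,\dots,A_r,\,B_1,\dots,B_M,\,j(Z)B_1,\dots,j(Z)B_M,\,Z_1,\dots,Z_s\}$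 be a basis of $\mathfrak{N}$ such that $A_i,B_j\in\mathfrak{V}$, $\ker j(Z)=\mathrm{span}\{A_1,\dots,A_r\}$, $\mathfrak{Z}=\mathrm{span}\{Z_1,\dots,Z_s\}$, and $R_Z(B_j)=\frac14\lambda_j^2B_j$ with $\lambda_j>0$ for $1\le j\le M$. Then: (i) $R_Z=-\frac14 j(Z)^2$ on $\mathfrak{V}$. (ii) For functions $a_i,b_j,c_j,d_\alpha:\mathbb{R}\to\mathbb{R}$, the vector field $$Y(t)=\sum_{i=1}^r a_i(t)A_i(\gamma(t))+\sum_{j=1}^M b_j(t)B_j(\gamma(t))+\sum_{j=1}^M c_j(t)\,(j(Z)B_j)(\gamma(t))+\sum_{\alpha=1}^s d_\alpha(t)Z_\alpha(\gamma(t))$$ along $\gamma$ is a Jacobi field if and only if every $a_i$ and every $d_\alpha$ is an affine function of $t$ and, for each $j$, there are real constants $\alpha_j,\beta_j,\gamma_j,\delta_j$ such that, for all $t$, $$b_j(t)=\alpha_j\cos(\lambda_jt)+\beta_j\sin(\lambda_jt)+\gamma_j,\qquad c_j(t)=-\frac{\beta_j}{\lambda_j}\cos(\lambda_jt)+\frac{\alpha_j}{\lambda_j}\sin(\lambda_jt)+\delta_j.$$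 (iii) The following vector fields along $\gamma$ form a basis of the real vector space of Jacobi fields along $\gamma$, and their first covariant derivatives are as indicated ($1\le i\le r$, $1\le\alpha\le s$, $1\le j\le M$): - $A_i(\gamma(t))$, with derivative $0$, and $tA_i(\gamma(t))$, with derivative $A_i(\gamma(t))$; - $Z_\alpha(\gamma(t))$, with derivative $0$, and $tZ_\alpha(\gamma(t))$, with derivative $Z_\alpha(\gamma(t))$; - $V_j(t)=B_j(\gamma(t))$ and $W_j(t)=(j(Z)B_j)(\gamma(t))$, with $V_j'=-\frac12W_j$ and $W_j'=\frac12\lambda_j^2V_j$; - $X_j(t)=\cos(\lambda_jt)\,B_j(\gamma(t))+\frac1{\lambda_j}\sin(\lambda_jt)\,(j(Z)B_j)(\gamma(t))$ and $Y_j(t)=\sin(\lambda_jt)\,B_j(\gamma(t))-\frac1{\lambda_j}\cos(\lambda_jt)\,(j(Z)B_j)(\gamma(t))$, with $X_j'=-\frac12\lambda_jY_j$ and $Y_j'=\frac12\lambda_jX_j$. -/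

import Mathlib

open scoped Manifold ContDiff
open Bundle

noncomputable section

section Manifold

variable {E : Type*} [NormedAddCommGroup E] [NormedSpace ℝ E]
  {N : Type*} [TopologicalSpace N] [ChartedSpace E N]

instance instFiniteDimensionalTangentSpace [h : FiniteDimensional ℝ E] (x : N) :
    FiniteDimensional ℝ (TangentSpace 𝓘(ℝ, E) x) := h

/-- The curvature `R(X, Y)W = ∇_X ∇_Y W - ∇_Y ∇_X W - ∇_[X,Y] W` of a connection on the tangent
bundle, for vector fields `X`, `Y`, `W`. Here `D W x u` is the value of `∇_u W` at `x`. -/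
def curvatureField [IsManifold 𝓘(ℝ, E) 1 N]
    (D : CovariantDerivative 𝓘(ℝ, E) E (TangentSpace 𝓘(ℝ, E) : N → Type _))
    (X Y W : Π x : N, TangentSpace 𝓘(ℝ, E) x) (x : N) : TangentSpace 𝓘(ℝ, E) x :=
  D (fun y ↦ D W y (Y y)) x (X x) - D (fun y ↦ D W y (X y)) x (Y x)
    - D W x (VectorField.mlieBracket 𝓘(ℝ, E) X Y x)

/-- `D` is the Levi-Civita connection of the Riemannian metric `g`: it is torsion free, and
compatible with the metric, that is, `u⟨V, W⟩ = ⟨∇_u V, W⟩ + ⟨V, ∇_u W⟩`. -/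
structure IsLeviCivita [FiniteDimensional ℝ E] [IsManifold 𝓘(ℝ, E) 1 N] [IsManifold 𝓘(ℝ, E) 2 N]
    (g : ContMDiffRiemannianMetric 𝓘(ℝ, E) ∞ E (TangentSpace 𝓘(ℝ, E) : N → Type _))
    (D : CovariantDerivative 𝓘(ℝ, E) E (TangentSpace 𝓘(ℝ, E) : N → Type _)) : Prop where
  torsion_eq_zero : D.torsion = 0
  metric {V W : Π x : N, TangentSpace 𝓘(ℝ, E) x} {x : N}
    (hV : MDiffAt (T% V) x) (hW : MDiffAt (T% W) x) (u : TangentSpace 𝓘(ℝ, E) x) :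
    (d% (fun y ↦ g.inner y (V y) (W y))) x u
      = g.inner x (D V x u) (W x) + g.inner x (V x) (D W x u)

/-- The velocity vector `γ'(t)` of a curve. -/
def velocity (γ : ℝ → N) (t : ℝ) : TangentSpace 𝓘(ℝ, E) (γ t) :=
  mfderiv% γ t (1 : ℝ)

end Manifold

section LieGroup

variable {E : Type*} [NormedAddCommGroup E] [NormedSpace ℝ E] [FiniteDimensional ℝ E]
  {N : Type*} [TopologicalSpace N] [ChartedSpace E N] [Group N]

instance instLieGroupMinSmoothness [LieGroup 𝓘(ℝ, E) ∞ N] :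
    LieGroup 𝓘(ℝ, E) (minSmoothness ℝ 3) N :=
  LieGroup.of_le (m := minSmoothness ℝ 3) (n := ∞) (by
    simp only [minSmoothness_of_isRCLikeNormedField]; exact ENat.LEInfty.out)

variable [LieGroup 𝓘(ℝ, E) ∞ N]
  (g : ContMDiffRiemannianMetric 𝓘(ℝ, E) ∞ E (TangentSpace 𝓘(ℝ, E) : N → Type _))
  (D : CovariantDerivative 𝓘(ℝ, E) E (TangentSpace 𝓘(ℝ, E) : N → Type _))

/-! ### The metric Lie algebra -/

variable (E N) in
/-- The Lie algebra `𝔫` of `N` is 2-step nilpotent: `[[X, Y], W] = 0` for all `X`, `Y`, `W`,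
but `𝔫` is not abelian. -/
structure IsTwoStepNilpotent : Prop where
  lie_lie_eq_zero (X Y W : GroupLieAlgebra 𝓘(ℝ, E) N) : ⁅⁅X, Y⁆, W⁆ = 0
  not_abelian : ∃ X Y : GroupLieAlgebra 𝓘(ℝ, E) N, ⁅X, Y⁆ ≠ 0

/-- The metric is invariant under all left translations. -/
def IsLeftInvariant : Prop :=
  ∀ (a x : N) (u v : TangentSpace 𝓘(ℝ, E) x),
    g.inner (a * x) (mfderiv% (a * ·) x u) (mfderiv% (a * ·) x v) = g.inner x u v

variable (E N) in
/-- The center `𝔷` of the Lie algebra `𝔫` of `N`. -/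
def lieCenter : Submodule ℝ (GroupLieAlgebra 𝓘(ℝ, E) N) :=
  (LieAlgebra.center ℝ (GroupLieAlgebra 𝓘(ℝ, E) N)).toSubmodule

variable (E N) in
/-- The commutator ideal `[𝔫, 𝔫]`. -/
def lieCommutator : Submodule ℝ (GroupLieAlgebra 𝓘(ℝ, E) N) :=
  (⁅(⊤ : LieIdeal ℝ (GroupLieAlgebra 𝓘(ℝ, E) N)),
    (⊤ : LieIdeal ℝ (GroupLieAlgebra 𝓘(ℝ, E) N))⁆).toSubmodule

/-- The inner product on the Lie algebra `𝔫 = T_1 N`. -/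
def lieInner : LinearMap.BilinForm ℝ (GroupLieAlgebra 𝓘(ℝ, E) N) :=
  (ContinuousLinearMap.coeLM ℝ).comp (g.inner 1).toLinearMap

/-- The orthogonal complement `𝔳` of the center `𝔷` in `𝔫`. -/
def lieV : Submodule ℝ (GroupLieAlgebra 𝓘(ℝ, E) N) :=
  (lieInner g).orthogonal (lieCenter E N)

lemma lieInner_restrict_nondegenerate (S : Submodule ℝ (GroupLieAlgebra 𝓘(ℝ, E) N)) :
    ((lieInner g).restrict S).Nondegenerate := by
  have key (x : S) (hx : lieInner g x x = 0) : x = 0 := by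
    by_contra h
    exact (g.pos 1 x (by simpa using h)).ne' hx
  exact ⟨fun x hx ↦ key x (hx x), fun x hx ↦ key x (hx x)⟩

/-- The skew symmetric map `j(Z) : 𝔳 → 𝔳` determined by `⟨j(Z) X, Y⟩ = ⟨[X, Y], Z⟩` for all `Y`
in `𝔳`: the functional on the right-hand side is represented by a vector of `𝔳`. -/
def jMap (Z : GroupLieAlgebra 𝓘(ℝ, E) N) : lieV g →ₗ[ℝ] lieV g :=
  (((lieInner g).restrict (lieV g)).toDual (lieInner_restrict_nondegenerate g _)).symm.toLinearMap ∘ₗ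
    LinearMap.mk₂ ℝ (fun X Y : lieV g ↦ lieInner g ⁅(X : GroupLieAlgebra 𝓘(ℝ, E) N), Y.1⁆ Z)
      (by intros; simp) (by intros; simp) (by intros; simp) (by intros; simp)

lemma lieInner_jMap (Z : GroupLieAlgebra 𝓘(ℝ, E) N) (X Y : lieV g) :
    lieInner g (jMap g Z X) Y = lieInner g ⁅(X : GroupLieAlgebra 𝓘(ℝ, E) N), Y.1⁆ Z :=
  LinearMap.BilinForm.apply_toDual_symm_apply (B := (lieInner g).restrict (lieV g))
    (hB := lieInner_restrict_nondegenerate g _) _ Y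

/-! ### Calculus along curves

Vector fields along curves are differentiated by the Leibniz rule in the global frame of
left-invariant vector fields. -/

/-- The vector of `𝔫` whose left-invariant vector field takes the value `u` at `x`: the image of
`u` under the derivative of left translation by `x⁻¹`. -/
def leftTrivialization (x : N) (u : TangentSpace 𝓘(ℝ, E) x) : GroupLieAlgebra 𝓘(ℝ, E) N :=
  mfderiv% (x⁻¹ * ·) x u

/-- The curvature tensor `R(u, v)w` on tangent vectors at `x`. By tensoriality, it can be computed
from any extensions of `u`, `v`, `w` to vector fields; the left-invariant ones are used. -/
def curvatureAt (x : N) (u v w : TangentSpace 𝓘(ℝ, E) x) : TangentSpace 𝓘(ℝ, E) x :=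
  curvatureField D (mulInvariantVectorField (leftTrivialization x u))
    (mulInvariantVectorField (leftTrivialization x v))
    (mulInvariantVectorField (leftTrivialization x w)) x

/-- The covariant derivative `Y'` of a vector field `Y` along a curve `γ`. If
`Y(t) = ∑ yᵢ(t) Eᵢ(γ(t))` for a basis of left-invariant vector fields `Eᵢ`, then
`Y'(t) = ∑ (yᵢ'(t) Eᵢ(γ(t)) + yᵢ(t) ∇_{γ'(t)} Eᵢ)`. -/
def covDerivAlong (γ : ℝ → N) (Y : Π t : ℝ, TangentSpace 𝓘(ℝ, E) (γ t)) (t : ℝ) :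
    TangentSpace 𝓘(ℝ, E) (γ t) :=
  mulInvariantVectorField (deriv (fun s ↦ leftTrivialization (γ s) (Y s)) t) (γ t)
    + D (mulInvariantVectorField (leftTrivialization (γ t) (Y t))) (γ t) (velocity γ t)

/-- `Y` is a Jacobi field along `γ`: a smooth vector field along `γ` with
`Y'' + R(Y, γ')γ' = 0`. -/
structure IsJacobiField (γ : ℝ → N) (Y : Π t : ℝ, TangentSpace 𝓘(ℝ, E) (γ t)) : Prop where
  smooth : CMDiff ∞ (fun t ↦ (⟨γ t, Y t⟩ : TangentBundle 𝓘(ℝ, E) N))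
  jacobi (t : ℝ) : covDerivAlong D γ (covDerivAlong D γ Y) t
    + curvatureAt D (γ t) (Y t) (velocity γ t) (velocity γ t) = 0

/-- `γ(t) = exp(t Z)`: the smooth integral curve, starting at the identity, of the left-invariant
vector field determined by `Z`. -/
structure IsExpCurve (Z : GroupLieAlgebra 𝓘(ℝ, E) N) (γ : ℝ → N) : Prop where
  smooth : CMDiff ∞ γ
  map_zero : γ 0 = 1
  isMIntegralCurve : IsMIntegralCurve γ (mulInvariantVectorField Z)

/-- The restriction to `γ` of the left-invariant vector field determined by `X`, that is, the field
`t ↦ X(γ(t))` along `γ`. -/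
def alongCurve (γ : ℝ → N) (X : GroupLieAlgebra 𝓘(ℝ, E) N) (t : ℝ) :
    TangentSpace 𝓘(ℝ, E) (γ t) :=
  mulInvariantVectorField X (γ t)

/-- `A₁, …, A_r, B₁, …, B_M, j(Z)B₁, …, j(Z)B_M, C₁, …, C_s` is a basis of `𝔫` such that the `Aᵢ`
span `ker j(Z)`, the `C_α` span the center, and `Bⱼ` is an eigenvector in `𝔳` of the curvature
operator `R_Z(X) = R(X, Z)Z` with eigenvalue `λⱼ² / 4`, where `λⱼ > 0`. -/
structure IsAdaptedBasis (Z : GroupLieAlgebra 𝓘(ℝ, E) N) {r M s : ℕ}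
    (A : Fin r → lieV g) (B : Fin M → lieV g) (C : Fin s → GroupLieAlgebra 𝓘(ℝ, E) N)
    (lam : Fin M → ℝ) : Prop where
  linearIndependent : LinearIndependent ℝ
    (Sum.elim (Sum.elim (fun i ↦ (A i).1) C)
      (Sum.elim (fun j ↦ (B j).1) (fun j ↦ (jMap g Z (B j)).1)))
  span_eq_top : Submodule.span ℝ (Set.range
    (Sum.elim (Sum.elim (fun i ↦ (A i).1) C)
      (Sum.elim (fun j ↦ (B j).1) (fun j ↦ (jMap g Z (B j)).1)))) = ⊤
  span_A : Submodule.span ℝ (Set.range A) = LinearMap.ker (jMap g Z)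
  span_C : Submodule.span ℝ (Set.range C) = lieCenter E N
  lam_pos (j : Fin M) : 0 < lam j
  curvature_B (j : Fin M) :
    curvatureAt D (1 : N) (B j).1 Z Z = ((1 / 4 : ℝ) * lam j ^ 2) • (B j).1

/-- The field `X_j(t) = cos(λ t) B(γ(t)) + (1/λ) sin(λ t) (j(Z)B)(γ(t))`. -/
def fieldX (Z : GroupLieAlgebra 𝓘(ℝ, E) N) (γ : ℝ → N) (B : lieV g) (lam : ℝ) (t : ℝ) :
    TangentSpace 𝓘(ℝ, E) (γ t) :=
  Real.cos (lam * t) • alongCurve γ B.1 t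
    + (1 / lam * Real.sin (lam * t)) • alongCurve γ (jMap g Z B).1 t

/-- The field `Y_j(t) = sin(λ t) B(γ(t)) - (1/λ) cos(λ t) (j(Z)B)(γ(t))`. -/
def fieldY (Z : GroupLieAlgebra 𝓘(ℝ, E) N) (γ : ℝ → N) (B : lieV g) (lam : ℝ) (t : ℝ) :
    TangentSpace 𝓘(ℝ, E) (γ t) :=
  Real.sin (lam * t) • alongCurve γ B.1 t
    - (1 / lam * Real.cos (lam * t)) • alongCurve γ (jMap g Z B).1 t

/-- The family of vector fields `Aᵢ, t Aᵢ, C_α, t C_α, V_j, W_j, X_j, Y_j` along `γ`, where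
`V_j = B_j` and `W_j = j(Z)B_j`. -/
def jacobiFamily (Z : GroupLieAlgebra 𝓘(ℝ, E) N) (γ : ℝ → N) {r M s : ℕ}
    (A : Fin r → lieV g) (B : Fin M → lieV g) (C : Fin s → GroupLieAlgebra 𝓘(ℝ, E) N)
    (lam : Fin M → ℝ) :
    ((Fin r ⊕ Fin r) ⊕ (Fin s ⊕ Fin s)) ⊕ ((Fin M ⊕ Fin M) ⊕ (Fin M ⊕ Fin M)) →
      Π t : ℝ, TangentSpace 𝓘(ℝ, E) (γ t) :=
  Sum.elim
    (Sum.elim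
      (Sum.elim (fun i ↦ alongCurve γ (A i).1) (fun i t ↦ t • alongCurve γ (A i).1 t))
      (Sum.elim (fun α ↦ alongCurve γ (C α)) (fun α t ↦ t • alongCurve γ (C α) t)))
    (Sum.elim
      (Sum.elim (fun j ↦ alongCurve γ (B j).1) (fun j ↦ alongCurve γ (jMap g Z (B j)).1))
      (Sum.elim (fun j ↦ fieldX g Z γ (B j) (lam j)) (fun j ↦ fieldY g Z γ (B j) (lam j))))

end LieGroup

end

set_option linter.unusedSectionVars false

noncomputable section

/-! ### Left-invariant fields, the Koszul formula and curvature on the Lie algebra -/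

section LeftInvariant

variable {E : Type*} [NormedAddCommGroup E] [NormedSpace ℝ E] [FiniteDimensional ℝ E]
  {N : Type*} [TopologicalSpace N] [ChartedSpace E N] [Group N] [LieGroup 𝓘(ℝ, E) ∞ N]
  (g : ContMDiffRiemannianMetric 𝓘(ℝ, E) ∞ E (TangentSpace 𝓘(ℝ, E) : N → Type _))
  (D : CovariantDerivative 𝓘(ℝ, E) E (TangentSpace 𝓘(ℝ, E) : N → Type _))

/-! Left-invariant fields trivialize the tangent bundle, so a field along `γ` is a curve `y` in the
fixed vector space `𝔫`, and smoothness on either side means the same thing. By the Koszul formula,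
`∇` of left-invariant fields is again left-invariant; hence the connection and the curvature are
algebraic operations on `𝔫`, recorded by `lieConnection`.

Nilpotency makes `Z` central. Put `L = ∇_Z`. Koszul gives `L = 0` on the center and `L = -½ j(Z)` on
`𝔳`. Moreover `∇_X Z = ∇_Z X`, whence `R(X, Z)Z = -L²X`, which is `-¼ j(Z)²X` for `X` in `𝔳`. Since
`γ' = Z`, covariant differentiation along `γ` is `d/dt + L`, and the Jacobi equation becomes `(d/dt
+ L)²y - L²y = 0`, that is, `y'' + 2Ly' = 0` (`IsExpCurve.isJacobiField_iff`).

In the adapted basis `L` kills the `A` and `C` vectors and preserves each plane spanned by `B_j` and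
`j(Z)B_j`. The equation decouples into `a'' = 0`, `d'' = 0`, `b'' = -λ²c'`, `c'' = b'`, which is
solved explicitly (`deriv_deriv_add_two_smul_eq_zero_iff`). The listed fields are the fundamental
solutions of this system, and their covariant derivatives follow from the values of `L` on the
basis. -/

lemma mdifferentiableAt_mul_left_smooth (a x : N) :
    MDiffAt (a * · : N → N) x :=
  (contMDiff_mul_left (I := 𝓘(ℝ, E)) (n := ∞) (a := a)).contMDiffAt.mdifferentiableAt (by simp)

lemma mfderiv_mul_left_comp (a b x : N) (u : TangentSpace 𝓘(ℝ, E) x) :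
    (mfderiv% (a * · : N → N) (b * x) (mfderiv% (b * · : N → N) x u) : E)
      = mfderiv% (a * b * · : N → N) x u := by
  have h : (a * b * · : N → N) = (a * ·) ∘ (b * ·) := by ext; simp [mul_assoc]
  rw [h, mfderiv_comp (I' := 𝓘(ℝ, E)) x (mdifferentiableAt_mul_left_smooth a _)
    (mdifferentiableAt_mul_left_smooth b _)]
  rfl

lemma mfderiv_one_mul (a x : N) (ha : a = 1) (u : TangentSpace 𝓘(ℝ, E) x) :
    (mfderiv% (a * · : N → N) x u : E) = u := by
  subst ha
  have h : (1 * · : N → N) = id := by ext; simp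
  rw [h, mfderiv_id]
  rfl

lemma leftTrivialization_mulInvariantVectorField (X : GroupLieAlgebra 𝓘(ℝ, E) N) (x : N) :
    leftTrivialization x (mulInvariantVectorField X x) = X := by
  have h := mfderiv_mul_left_comp (E := E) x⁻¹ x 1 X
  rw [mfderiv_one_mul (x⁻¹ * x) _ (by simp), mul_one] at h
  exact h

lemma mulInvariantVectorField_leftTrivialization (x : N) (u : TangentSpace 𝓘(ℝ, E) x) :
    mulInvariantVectorField (leftTrivialization x u) x = u := by
  have h := mfderiv_mul_left_comp (E := E) x x⁻¹ x u
  rw [mfderiv_one_mul (x * x⁻¹) _ (by simp), inv_mul_cancel] at h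
  exact h

/-- Evaluation at `x` of left-invariant vector fields. -/
def mulInvariantEquiv (x : N) :
    GroupLieAlgebra 𝓘(ℝ, E) N ≃ₗ[ℝ] TangentSpace 𝓘(ℝ, E) x where
  toFun X := mulInvariantVectorField X x
  map_add' X Y := by rw [mulInvariantVectorField_add]; rfl
  map_smul' c X := by rw [mulInvariantVectorField_smul]; rfl
  invFun := leftTrivialization x
  left_inv X := leftTrivialization_mulInvariantVectorField X x
  right_inv u := mulInvariantVectorField_leftTrivialization x u

lemma mulInvariantVectorField_one (X : GroupLieAlgebra 𝓘(ℝ, E) N) :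
    mulInvariantVectorField X (1 : N) = X :=
  mfderiv_one_mul (E := E) 1 (1 : N) rfl X

variable {g} in
lemma IsLeftInvariant.inner_mulInvariantVectorField (hg : IsLeftInvariant g)
    (X Y : GroupLieAlgebra 𝓘(ℝ, E) N) (x : N) :
    g.inner x (mulInvariantVectorField X x) (mulInvariantVectorField Y x) = lieInner g X Y := by
  have h := hg x 1 X Y
  rw [mul_one] at h
  exact h

variable {g D}

lemma IsLeviCivita.torsion_mulInvariantVectorField (hD : IsLeviCivita g D)
    (X Y : GroupLieAlgebra 𝓘(ℝ, E) N) (x : N) :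
    D (mulInvariantVectorField Y) x (mulInvariantVectorField X x)
      - D (mulInvariantVectorField X) x (mulInvariantVectorField Y x)
      = mulInvariantVectorField ⁅X, Y⁆ x := by
  rw [GroupLieAlgebra.bracket_def, mulInvariantVector_mlieBracket]
  exact (D.torsion_eq_zero_iff.1 hD.torsion_eq_zero)
    (mdifferentiableAt_mulInvariantVectorField X) (mdifferentiableAt_mulInvariantVectorField Y)

/-- The inner product of two left-invariant fields is a constant function, so metric compatibility
makes `∇_u` skew on them. -/
lemma IsLeviCivita.inner_mulInvariantVectorField_skew (hD : IsLeviCivita g D)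
    (hg : IsLeftInvariant g) (V W : GroupLieAlgebra 𝓘(ℝ, E) N) (x : N)
    (u : TangentSpace 𝓘(ℝ, E) x) :
    g.inner x (D (mulInvariantVectorField V) x u) (mulInvariantVectorField W x)
      + g.inner x (mulInvariantVectorField V x) (D (mulInvariantVectorField W) x u) = 0 := by
  rw [← hD.metric (mdifferentiableAt_mulInvariantVectorField V)
    (mdifferentiableAt_mulInvariantVectorField W) u]
  simp only [hg.inner_mulInvariantVectorField]
  simp [mvfderiv]

/-- The Koszul formula for left-invariant vector fields. -/
lemma IsLeviCivita.koszul (hD : IsLeviCivita g D) (hg : IsLeftInvariant g)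
    (X Y W : GroupLieAlgebra 𝓘(ℝ, E) N) (x : N) :
    2 * g.inner x (D (mulInvariantVectorField Y) x (mulInvariantVectorField X x))
        (mulInvariantVectorField W x)
      = lieInner g ⁅X, Y⁆ W - lieInner g ⁅Y, W⁆ X + lieInner g ⁅W, X⁆ Y := by
  -- Three cyclic skewness relations and three torsion relations; the formula is a linear
  -- combination of these six.
  have s1 := hD.inner_mulInvariantVectorField_skew hg Y W x (mulInvariantVectorField X x)
  have s2 := hD.inner_mulInvariantVectorField_skew hg W X x (mulInvariantVectorField Y x)
  have s3 := hD.inner_mulInvariantVectorField_skew hg X Y x (mulInvariantVectorField W x)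
  have t (X Y W : GroupLieAlgebra 𝓘(ℝ, E) N) :
      g.inner x (D (mulInvariantVectorField Y) x (mulInvariantVectorField X x))
          (mulInvariantVectorField W x)
        - g.inner x (D (mulInvariantVectorField X) x (mulInvariantVectorField Y x))
          (mulInvariantVectorField W x) = lieInner g ⁅X, Y⁆ W := by
    rw [← hg.inner_mulInvariantVectorField _ _ x, ← hD.torsion_mulInvariantVectorField, map_sub]
    rfl
  have t1 := t X Y W
  have t2 := t Y W X
  have t3 := t W X Y
  rw [g.symm x (mulInvariantVectorField _ x)] at s1 s2 s3
  linarith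

/-- The covariant derivative of left-invariant vector fields, as a bilinear map on `𝔫`. -/
def lieConnection (D : CovariantDerivative 𝓘(ℝ, E) E (TangentSpace 𝓘(ℝ, E) : N → Type _))
    (X : GroupLieAlgebra 𝓘(ℝ, E) N) :
    GroupLieAlgebra 𝓘(ℝ, E) N →ₗ[ℝ] GroupLieAlgebra 𝓘(ℝ, E) N where
  toFun Y := D (mulInvariantVectorField Y) 1 X
  map_add' Y Y' := by
    rw [mulInvariantVectorField_add, D.isCovariantDerivativeOnUniv.add
      (mdifferentiableAt_mulInvariantVectorField Y) (mdifferentiableAt_mulInvariantVectorField Y')]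
    rfl
  map_smul' c Y := by
    rw [mulInvariantVectorField_smul, D.isCovariantDerivativeOnUniv.smul_const c
      (mdifferentiableAt_mulInvariantVectorField Y)]
    rfl

lemma lieInner_pos (X : GroupLieAlgebra 𝓘(ℝ, E) N) (h : X ≠ 0) : 0 < lieInner g X X := g.pos 1 X h

lemma lieInner_symm (X Y : GroupLieAlgebra 𝓘(ℝ, E) N) : lieInner g X Y = lieInner g Y X :=
  g.symm 1 X Y

lemma eq_of_lieInner_eq {X Y : GroupLieAlgebra 𝓘(ℝ, E) N}
    (h : ∀ W, lieInner g X W = lieInner g Y W) : X = Y := by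
  by_contra hne
  have := lieInner_pos (g := g) (X - Y) (sub_ne_zero.2 hne)
  simp [h] at this

lemma IsLeviCivita.two_mul_lieInner_lieConnection (hD : IsLeviCivita g D) (hg : IsLeftInvariant g)
    (X Y W : GroupLieAlgebra 𝓘(ℝ, E) N) :
    2 * lieInner g (lieConnection D X Y) W
      = lieInner g ⁅X, Y⁆ W - lieInner g ⁅Y, W⁆ X + lieInner g ⁅W, X⁆ Y := by
  rw [← hD.koszul hg X Y W 1]
  simp only [mulInvariantVectorField_one]
  rfl

/-- The right-hand side of the Koszul formula does not depend on the point, and the metric is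
definite, so the value at `1` determines the value at every `x`. -/
lemma IsLeviCivita.apply_mulInvariantVectorField (hD : IsLeviCivita g D) (hg : IsLeftInvariant g)
    (X Y : GroupLieAlgebra 𝓘(ℝ, E) N) (x : N) :
    D (mulInvariantVectorField Y) x (mulInvariantVectorField X x)
      = mulInvariantVectorField (lieConnection D X Y) x := by
  set u := D (mulInvariantVectorField Y) x (mulInvariantVectorField X x) with hu
  rw [← mulInvariantVectorField_leftTrivialization x u]
  congr 1
  refine eq_of_lieInner_eq (g := g) fun W ↦ ?_
  have h := hD.koszul hg X Y W x
  rw [← hD.two_mul_lieInner_lieConnection hg, ← hu,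
    ← mulInvariantVectorField_leftTrivialization x u, hg.inner_mulInvariantVectorField] at h
  linarith

lemma IsLeviCivita.curvatureAt_mulInvariantVectorField (hD : IsLeviCivita g D)
    (hg : IsLeftInvariant g) (X Y W : GroupLieAlgebra 𝓘(ℝ, E) N) (x : N) :
    curvatureAt D x (mulInvariantVectorField X x) (mulInvariantVectorField Y x)
        (mulInvariantVectorField W x)
      = mulInvariantVectorField (lieConnection D X (lieConnection D Y W)
          - lieConnection D Y (lieConnection D X W) - lieConnection D ⁅X, Y⁆ W) x := by
  simp only [curvatureAt, curvatureField, leftTrivialization_mulInvariantVectorField,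
    ← mulInvariantVector_mlieBracket X Y, ← GroupLieAlgebra.bracket_def,
    hD.apply_mulInvariantVectorField hg]
  change mulInvariantEquiv x _ - mulInvariantEquiv x _ - mulInvariantEquiv x _
    = mulInvariantEquiv x _
  simp

end LeftInvariant

/-! ### Smoothness and covariant derivatives along curves -/

section Curves

variable {E : Type*} [NormedAddCommGroup E] [NormedSpace ℝ E] [FiniteDimensional ℝ E]
  {N : Type*} [TopologicalSpace N] [ChartedSpace E N] [Group N] [LieGroup 𝓘(ℝ, E) ∞ N]
  {g : ContMDiffRiemannianMetric 𝓘(ℝ, E) ∞ E (TangentSpace 𝓘(ℝ, E) : N → Type _)}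
  {D : CovariantDerivative 𝓘(ℝ, E) E (TangentSpace 𝓘(ℝ, E) : N → Type _)}

/-- Left translation, by a smoothly varying element, of a smooth curve in the tangent bundle. -/
lemma contMDiff_mfderiv_mul_left {η γ : ℝ → N} (hη : CMDiff ∞ η)
    {Y : Π t : ℝ, TangentSpace 𝓘(ℝ, E) (γ t)}
    (hY : CMDiff ∞ (fun t ↦ (⟨γ t, Y t⟩ : TangentBundle 𝓘(ℝ, E) N))) :
    CMDiff ∞ (fun t ↦ (⟨η t * γ t, mfderiv% (η t * · : N → N) (γ t) (Y t)⟩ :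
      TangentBundle 𝓘(ℝ, E) N)) := by
  -- Apply the tangent map of multiplication to the pair (zero vector at `η t`, `Y t`). The product
  -- rule leaves only the derivative of left translation, since the other factor contributes the
  -- image of `0`.
  let fg : ℝ → TangentBundle 𝓘(ℝ, E) N := fun t ↦ ⟨η t, 0⟩
  have sfg : CMDiff ∞ fg :=
    (contMDiff_zeroSection ℝ (TangentSpace 𝓘(ℝ, E) : N → Type _)).comp hη
  let F₁ : ℝ → (TangentBundle 𝓘(ℝ, E) N × TangentBundle 𝓘(ℝ, E) N) :=
    fun t ↦ (fg t, ⟨γ t, Y t⟩)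
  have S₁ : CMDiff ∞ F₁ := sfg.prodMk hY
  let F₂ : (TangentBundle 𝓘(ℝ, E) N × TangentBundle 𝓘(ℝ, E) N) →
      TangentBundle (𝓘(ℝ, E).prod 𝓘(ℝ, E)) (N × N) :=
    (equivTangentBundleProd 𝓘(ℝ, E) N 𝓘(ℝ, E) N).symm
  have S₂ : CMDiff ∞ F₂ := contMDiff_equivTangentBundleProd_symm
  let F₃ : TangentBundle (𝓘(ℝ, E).prod 𝓘(ℝ, E)) (N × N) → TangentBundle 𝓘(ℝ, E) N :=
    tangentMap% (fun (p : N × N) ↦ p.1 * p.2)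
  have S₃ : CMDiff ∞ F₃ :=
    ContMDiff.contMDiff_tangentMap (contMDiff_mul 𝓘(ℝ, E) ∞) (m := ∞) le_rfl
  convert! (S₃.comp S₂).comp S₁ with t
  simp only [Function.comp_apply, tangentMap, F₃, F₂, F₁, fg]
  rw [mfderiv_prod_eq_add_apply ((contMDiff_mul 𝓘(ℝ, E) ∞).mdifferentiableAt (by simp))]
  exact ((congrArg (· + mfderiv% (η t * · : N → N) (γ t) (Y t))
    (map_zero (mfderiv% (· * γ t : N → N) (η t)))).trans (zero_add _)).symm

/-- The preferred trivialization at `x` is the identity on the fibre over `x`. -/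
lemma contMDiff_tangentBundle_mk_const_iff (x : N) (y : ℝ → E) :
    CMDiff ∞ (fun t ↦ (⟨x, y t⟩ : TangentBundle 𝓘(ℝ, E) N)) ↔ ContDiff ℝ ∞ y := by
  have h (t : ℝ) : (trivializationAt E (TangentSpace 𝓘(ℝ, E)) x
      (⟨x, y t⟩ : TangentBundle 𝓘(ℝ, E) N)).2 = y t :=
    congrArg Prod.snd ((tangentBundleCore 𝓘(ℝ, E) N).localTrivAt_apply_mk x (y t))
  rw [← contMDiff_iff_contDiff]
  refine forall_congr' fun t ↦ ?_
  rw [Bundle.contMDiffAt_totalSpace]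
  simp only [h]
  exact and_iff_right contMDiffAt_const

lemma tangentBundle_mk_congr {x x' : N} (hx : x = x') {u : TangentSpace 𝓘(ℝ, E) x}
    {u' : TangentSpace 𝓘(ℝ, E) x'} (hu : (u : E) = u') :
    (⟨x, u⟩ : TangentBundle 𝓘(ℝ, E) N) = ⟨x', u'⟩ := by
  subst hx
  exact congrArg _ hu

/-- Translating by `γ⁻¹` brings the field into the single fibre over `1`, and translating by `γ`
brings it back. -/
lemma contMDiff_mulInvariantVectorField_along_iff {γ : ℝ → N} (hγ : CMDiff ∞ γ)
    (y : ℝ → E) :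
    CMDiff ∞ (fun t ↦ (⟨γ t, mulInvariantVectorField (I := 𝓘(ℝ, E)) (y t) (γ t)⟩ :
      TangentBundle 𝓘(ℝ, E) N)) ↔ ContDiff ℝ ∞ y := by
  rw [← contMDiff_tangentBundle_mk_const_iff (1 : N)]
  constructor <;> intro h
  · convert! contMDiff_mfderiv_mul_left (hγ.inv) h with t
    exact tangentBundle_mk_congr (by simp)
      (leftTrivialization_mulInvariantVectorField (y t) (γ t)).symm
  · have := contMDiff_mfderiv_mul_left (γ := fun _ ↦ (1 : N)) (Y := y) hγ h
    convert! this with t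
    · simp

lemma IsExpCurve.velocity_eq {Z : GroupLieAlgebra 𝓘(ℝ, E) N} {γ : ℝ → N} (hγ : IsExpCurve Z γ)
    (t : ℝ) : velocity γ t = mulInvariantVectorField Z (γ t) := by
  rw [velocity, (hγ.isMIntegralCurve t).mfderiv]
  exact one_smul ℝ (mulInvariantVectorField Z (γ t))

lemma IsExpCurve.covDerivAlong_eq (hD : IsLeviCivita g D) (hg : IsLeftInvariant g)
    {Z : GroupLieAlgebra 𝓘(ℝ, E) N} {γ : ℝ → N} (hγ : IsExpCurve Z γ)
    (y : ℝ → GroupLieAlgebra 𝓘(ℝ, E) N) (t : ℝ) :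
    covDerivAlong D γ (fun t ↦ mulInvariantVectorField (y t) (γ t)) t
      = mulInvariantVectorField (deriv y t + lieConnection D Z (y t)) (γ t) := by
  simp only [covDerivAlong, leftTrivialization_mulInvariantVectorField, hγ.velocity_eq,
    hD.apply_mulInvariantVectorField hg, mulInvariantVectorField_add]
  rfl

end Curves

/-! ### The scalar equations -/

section ODE

/-- The solutions of `c'' = b'`, `b'' = -λ² c'`. -/
lemma exists_eq_trig_of_deriv_deriv {l : ℝ} (hl : l ≠ 0) {b c : ℝ → ℝ}
    (hb : ContDiff ℝ ∞ b) (hc : ContDiff ℝ ∞ c)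
    (h₁ : ∀ t, deriv (deriv b) t = -l ^ 2 * deriv c t)
    (h₂ : ∀ t, deriv (deriv c) t = deriv b t) :
    ∃ α β κ δ : ℝ, ∀ t,
      b t = α * Real.cos (l * t) + β * Real.sin (l * t) + κ ∧
      c t = -(β / l) * Real.cos (l * t) + α / l * Real.sin (l * t) + δ := by
  have db (t) : HasDerivAt b (deriv b t) t := (hb.differentiable (by simp) t).hasDerivAt
  have dc (t) : HasDerivAt c (deriv c t) t := (hc.differentiable (by simp) t).hasDerivAt
  have ddb (t) : HasDerivAt (deriv b) (-l ^ 2 * deriv c t) t :=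
    h₁ t ▸ (((contDiff_infty_iff_deriv.1 hb).2.differentiable (by simp)) t).hasDerivAt
  have ddc (t) : HasDerivAt (deriv c) (deriv b t) t :=
    h₂ t ▸ (((contDiff_infty_iff_deriv.1 hc).2.differentiable (by simp)) t).hasDerivAt
  have hlt (t : ℝ) : HasDerivAt (fun t ↦ l * t) l t := by
    simpa using (hasDerivAt_id t).const_mul l
  have dcos (t : ℝ) := (hlt t).cos
  have dsin (t : ℝ) := (hlt t).sin
  have const {f : ℝ → ℝ} (hf : ∀ t, HasDerivAt f 0 t) (t : ℝ) : f t = f 0 :=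
    is_const_of_deriv_eq_zero (fun t ↦ (hf t).differentiableAt) (fun t ↦ (hf t).deriv) t 0
  -- The pair `(c', b'/l)` rotates with angular speed `l`. Undoing the rotation gives two first
  -- integrals, whose values at `0` are `α` and `β` below.
  have k₁ := const (f := fun t ↦ deriv c t * Real.cos (l * t) - deriv b t / l * Real.sin (l * t))
    fun t ↦ by
      refine (((ddc t).mul (dcos t)).sub (((ddb t).div_const l).mul (dsin t))).congr_deriv ?_
      field_simp; ring
  have k₂ := const (f := fun t ↦ deriv c t * Real.sin (l * t) + deriv b t / l * Real.cos (l * t))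
    fun t ↦ by
      refine (((ddc t).mul (dsin t)).add (((ddb t).div_const l).mul (dcos t))).congr_deriv ?_
      field_simp; ring
  simp only [mul_zero, Real.cos_zero, Real.sin_zero, mul_one, sub_zero, zero_add] at k₁ k₂
  set α := deriv c 0 with hα
  set β := deriv b 0 / l with hβ
  have eb (t) : deriv b t = l * (β * Real.cos (l * t) - α * Real.sin (l * t)) := by
    have e1 := k₁ t
    have e2 := k₂ t
    have e3 := Real.sin_sq_add_cos_sq (l * t)
    have : deriv b t / l = β * Real.cos (l * t) - α * Real.sin (l * t) := by
      linear_combination Real.cos (l * t) * e2 - Real.sin (l * t) * e1 - deriv b t / l * e3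
    rw [← this]; field_simp
  have ec (t) : deriv c t = α * Real.cos (l * t) + β * Real.sin (l * t) := by
    linear_combination Real.cos (l * t) * k₁ t + Real.sin (l * t) * k₂ t
      - deriv c t * Real.sin_sq_add_cos_sq (l * t)
  have m₁ := const (f := fun t ↦ b t - (α * Real.cos (l * t) + β * Real.sin (l * t))) fun t ↦ by
    refine ((db t).sub (((dcos t).const_mul α).add ((dsin t).const_mul β))).congr_deriv ?_
    rw [eb]; ring
  have m₂ := const (f := fun t ↦ c t - (-(β / l) * Real.cos (l * t) + α / l * Real.sin (l * t)))
    fun t ↦ by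
      refine ((dc t).sub (((dcos t).const_mul (-(β / l))).add
        ((dsin t).const_mul (α / l)))).congr_deriv ?_
      rw [ec]; field_simp; ring
  refine ⟨α, β, b 0 - (α * Real.cos (l * 0) + β * Real.sin (l * 0)),
    c 0 - (-(β / l) * Real.cos (l * 0) + α / l * Real.sin (l * 0)), fun t ↦ ⟨?_, ?_⟩⟩
  · linear_combination m₁ t
  · linear_combination m₂ t

lemma exists_eq_affine_of_deriv_deriv {a : ℝ → ℝ} (ha : ContDiff ℝ ∞ a)
    (h : ∀ t, deriv (deriv a) t = 0) : ∃ p q : ℝ, ∀ t, a t = p + q * t := by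
  have da (t) : HasDerivAt a (deriv a t) t := (ha.differentiable (by simp) t).hasDerivAt
  have h' (t) : deriv a t = deriv a 0 :=
    is_const_of_deriv_eq_zero ((contDiff_infty_iff_deriv.1 ha).2.differentiable (by simp)) h t 0
  have h₂ (t) : HasDerivAt (fun t ↦ a t - deriv a 0 * t) 0 t := by
    refine ((da t).sub ((hasDerivAt_id t).const_mul (deriv a 0))).congr_deriv ?_
    rw [h' t]; simp
  refine ⟨a 0, deriv a 0, fun t ↦ ?_⟩
  have := is_const_of_deriv_eq_zero (fun t ↦ (h₂ t).differentiableAt) (fun t ↦ (h₂ t).deriv) t 0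
  simp only [mul_zero, sub_zero] at this
  linarith

lemma deriv_trig (l α β κ : ℝ) :
    deriv (fun t ↦ α * Real.cos (l * t) + β * Real.sin (l * t) + κ)
      = fun t ↦ (β * l) * Real.cos (l * t) + -(α * l) * Real.sin (l * t) + 0 := by
  ext t
  have hlt : HasDerivAt (fun t ↦ l * t) l t := by simpa using (hasDerivAt_id t).const_mul l
  refine HasDerivAt.deriv ((((hlt.cos.const_mul α).add (hlt.sin.const_mul β)).add_const
    κ).congr_deriv ?_)
  ring

end ODE

/-! ### The equation `y'' + 2Ly' = 0` and its fundamental solutions -/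

section VectorODE

variable {V : Type*} [NormedAddCommGroup V] [NormedSpace ℝ V]

lemma deriv_sum_smul_const {ι : Type*} [Fintype ι] (e : ι → V) {f : ι → ℝ → ℝ}
    (hf : ∀ i, Differentiable ℝ (f i)) :
    deriv (fun t ↦ ∑ i, f i t • e i) = fun t ↦ ∑ i, deriv (f i) t • e i := by
  ext t
  exact (HasDerivAt.fun_sum fun i _ ↦ ((hf i t).hasDerivAt.smul_const (e i))).deriv

/-- Coordinates with respect to an independent family are linear functions of the vector: compose
with a left inverse of the linear combination map. -/
lemma contDiff_sum_smul_const_iff [FiniteDimensional ℝ V] {ι : Type*} [Fintype ι] {e : ι → V}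
    (he : LinearIndependent ℝ e) {f : ι → ℝ → ℝ} :
    ContDiff ℝ ∞ (fun t ↦ ∑ i, f i t • e i) ↔ ∀ i, ContDiff ℝ ∞ (f i) := by
  classical
  constructor
  · intro h i
    obtain ⟨φ, hφ⟩ := (Fintype.linearCombination ℝ e).exists_leftInverse_of_injective
      (LinearMap.ker_eq_bot.2 (he.fintypeLinearCombination_injective))
    have : f i = fun t ↦ φ.toContinuousLinearMap (∑ i, f i t • e i) i := by
      ext t
      exact congrFun (LinearMap.congr_fun hφ fun i ↦ f i t).symm i
    rw [this]
    exact (contDiff_apply ℝ ℝ i).comp (φ.toContinuousLinearMap.contDiff.comp h)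
  · intro h
    exact ContDiff.sum fun i _ ↦ (h i).smul contDiff_const

lemma deriv_deriv_add_linearMap [FiniteDimensional ℝ V] (L : V →ₗ[ℝ] V) {y : ℝ → V}
    (hy : ContDiff ℝ ∞ y) (t : ℝ) :
    deriv (fun t ↦ deriv y t + L (y t)) t = deriv (deriv y) t + L (deriv y t) :=
  (((contDiff_infty_iff_deriv.1 hy).2.differentiable (by simp) t).hasDerivAt.add
    (L.toContinuousLinearMap.hasFDerivAt.comp_hasDerivAt t
      (hy.differentiable (by simp) t).hasDerivAt)).deriv

variable {r M s : ℕ} {A : Fin r → V} {C : Fin s → V} {B B' : Fin M → V} {lam : Fin M → ℝ}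

/-- `y'' + 2 L y' = 0` in coordinates, for `L` with kernel vectors `A`, `C` and planes `B`, `B'` on
which `L` is skew. -/
theorem deriv_deriv_add_two_smul_eq_zero_iff [FiniteDimensional ℝ V]
    (he : LinearIndependent ℝ (Sum.elim (Sum.elim A C) (Sum.elim B B')))
    (hlam : ∀ j, lam j ≠ 0) {L : V →ₗ[ℝ] V} (hA : ∀ i, L (A i) = 0) (hC : ∀ i, L (C i) = 0)
    (hB : ∀ j, L (B j) = (-(1 / 2) : ℝ) • B' j)
    (hB' : ∀ j, L (B' j) = ((1 / 2 : ℝ) * lam j ^ 2) • B j)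
    (a : Fin r → ℝ → ℝ) (b c : Fin M → ℝ → ℝ) (d : Fin s → ℝ → ℝ) {y : ℝ → V}
    (hy : y = fun t ↦ ∑ i, a i t • A i + ∑ j, b j t • B j + ∑ j, c j t • B' j
      + ∑ k, d k t • C k) :
    (ContDiff ℝ ∞ y ∧ ∀ t, deriv (deriv y) t + (2 : ℝ) • L (deriv y t) = 0) ↔
      (∀ i, ∃ p q : ℝ, ∀ t, a i t = p + q * t) ∧
      (∀ k, ∃ p q : ℝ, ∀ t, d k t = p + q * t) ∧
      (∀ j, ∃ α β κ δ : ℝ, ∀ t,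
        b j t = α * Real.cos (lam j * t) + β * Real.sin (lam j * t) + κ ∧
        c j t = -(β / lam j) * Real.cos (lam j * t) + α / lam j * Real.sin (lam j * t) + δ) := by
  let e := Sum.elim (Sum.elim A C) (Sum.elim B B')
  let f := Sum.elim (Sum.elim a d) (Sum.elim b c)
  have hy' : y = fun t ↦ ∑ i, f i t • e i := by
    rw [hy]; ext t; simp [e, f]; abel
  rw [hy', contDiff_sum_smul_const_iff he]
  have main (hf : ∀ i, ContDiff ℝ ∞ (f i)) :
      (∀ t, deriv (deriv fun t ↦ ∑ i, f i t • e i) t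
        + (2 : ℝ) • L (deriv (fun t ↦ ∑ i, f i t • e i) t) = 0) ↔
      ∀ t, (∀ i, deriv (deriv (a i)) t = 0) ∧ (∀ k, deriv (deriv (d k)) t = 0) ∧
        (∀ j, deriv (deriv (b j)) t = -lam j ^ 2 * deriv (c j) t) ∧
        (∀ j, deriv (deriv (c j)) t = deriv (b j) t) := by
    rw [deriv_sum_smul_const e fun i ↦ (hf i).differentiable (by simp),
      deriv_sum_smul_const e fun i ↦ (contDiff_infty_iff_deriv.1 (hf i)).2.differentiable (by simp)]
    refine forall_congr' fun t ↦ ?_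
    -- The coordinates of `y'' + 2Ly'`: the factor `2` cancels the halves in `L`, so each plane
    -- contributes `b'' + λ²c'` and `c'' - b'`.
    let w : (Fin r ⊕ Fin s) ⊕ (Fin M ⊕ Fin M) → ℝ :=
      Sum.elim (Sum.elim (fun i ↦ deriv (deriv (a i)) t) (fun k ↦ deriv (deriv (d k)) t))
        (Sum.elim (fun j ↦ deriv (deriv (b j)) t + lam j ^ 2 * deriv (c j) t)
          (fun j ↦ deriv (deriv (c j)) t - deriv (b j) t))
    have hw : ∑ i, deriv (deriv (f i)) t • e i + (2 : ℝ) • L (∑ i, deriv (f i) t • e i)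
        = ∑ i, w i • e i := by
      simp only [Fintype.sum_sum_type, e, f, w, Sum.elim_inl, Sum.elim_inr, map_add, map_sum,
        map_smul, hA, hB, hC, hB', smul_zero, Finset.sum_const_zero, add_zero, zero_add,
        add_smul, sub_smul, Finset.sum_add_distrib, Finset.sum_sub_distrib, smul_add,
        Finset.smul_sum, smul_smul]
      have e₁ (j : Fin M) : 2 * (deriv (b j) t * -(1 / 2)) = - deriv (b j) t := by ring
      have e₂ (j : Fin M) :
          2 * (deriv (c j) t * (1 / 2 * lam j ^ 2)) = lam j ^ 2 * deriv (c j) t := by ring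
      simp only [e₁, e₂, neg_smul, Finset.sum_neg_distrib]
      abel
    rw [hw]
    have hz : ∑ i, w i • e i = 0 ↔ ∀ i, w i = 0 :=
      ⟨Fintype.linearIndependent_iff.1 he w, fun h ↦ by simp [h]⟩
    rw [hz]
    simp only [Sum.forall, w, Sum.elim_inl, Sum.elim_inr, and_assoc, sub_eq_zero, neg_mul,
      eq_neg_iff_add_eq_zero]
  constructor
  · rintro ⟨hf, h⟩
    rw [main hf] at h
    exact ⟨fun i ↦ exists_eq_affine_of_deriv_deriv (hf (.inl (.inl i))) fun t ↦ (h t).1 i,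
      fun k ↦ exists_eq_affine_of_deriv_deriv (hf (.inl (.inr k))) fun t ↦ (h t).2.1 k,
      fun j ↦ exists_eq_trig_of_deriv_deriv (hlam j) (hf (.inr (.inl j))) (hf (.inr (.inr j)))
        (fun t ↦ (h t).2.2.1 j) (fun t ↦ (h t).2.2.2 j)⟩
  · rintro ⟨ha, hd, hbc⟩
    choose p q ha using ha
    choose p' q' hd using hd
    choose α β κ δ hbc using hbc
    have ha (i) : a i = fun t ↦ p i + q i * t := funext (ha i)
    have hd (i) : d i = fun t ↦ p' i + q' i * t := funext (hd i)
    have hb (i) := funext fun t ↦ (hbc i t).1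
    have hc (i) := funext fun t ↦ (hbc i t).2
    have trig (l α β κ : ℝ) :
        ContDiff ℝ ∞ fun t ↦ α * Real.cos (l * t) + β * Real.sin (l * t) + κ := by fun_prop
    have hf : ∀ i, ContDiff ℝ ∞ (f i) := by
      rintro ((i | i) | (i | i)) <;> simp only [f, Sum.elim_inl, Sum.elim_inr]
      · rw [ha]; fun_prop
      · rw [hd]; fun_prop
      · rw [hb]; exact trig _ _ _ _
      · rw [hc]; exact trig _ _ _ _
    refine ⟨hf, (main hf).2 fun t ↦ ⟨fun i ↦ ?_, fun i ↦ ?_, fun j ↦ ?_, fun j ↦ ?_⟩⟩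
    · simp [ha]
    · simp [hd]
    · have := hlam j
      rw [hb, hc, deriv_trig, deriv_trig, deriv_trig]
      field_simp
      ring_nf
    · have := hlam j
      rw [hb, hc, deriv_trig, deriv_trig, deriv_trig]
      field_simp

variable (A C B B' lam) in
/-- The fundamental solutions of `y'' + 2 L y' = 0`. -/
def solutionFamily :
    ((Fin r ⊕ Fin r) ⊕ (Fin s ⊕ Fin s)) ⊕ ((Fin M ⊕ Fin M) ⊕ (Fin M ⊕ Fin M)) → ℝ → V :=
  Sum.elim
    (Sum.elim
      (Sum.elim (fun i _ ↦ A i) (fun i t ↦ t • A i))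
      (Sum.elim (fun k _ ↦ C k) (fun k t ↦ t • C k)))
    (Sum.elim
      (Sum.elim (fun j _ ↦ B j) (fun j _ ↦ B' j))
      (Sum.elim
        (fun j t ↦ Real.cos (lam j * t) • B j + (1 / lam j * Real.sin (lam j * t)) • B' j)
        (fun j t ↦ Real.sin (lam j * t) • B j - (1 / lam j * Real.cos (lam j * t)) • B' j)))

/-- Puts a combination of the fundamental solutions in the shape of the general solution: the
coefficients of the two oscillating fields are `α` and `β`, those of the two constant fields `κ` and
`δ`. -/
lemma sum_smul_solutionFamily
    (x : ((Fin r ⊕ Fin r) ⊕ (Fin s ⊕ Fin s)) ⊕ ((Fin M ⊕ Fin M) ⊕ (Fin M ⊕ Fin M)) → ℝ) (t : ℝ) :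
    (∑ i, x i • solutionFamily A C B B' lam i) t
      = ∑ i, (x (.inl (.inl (.inl i))) + x (.inl (.inl (.inr i))) * t) • A i
        + ∑ j, (x (.inr (.inr (.inl j))) * Real.cos (lam j * t)
          + x (.inr (.inr (.inr j))) * Real.sin (lam j * t) + x (.inr (.inl (.inl j)))) • B j
        + ∑ j, (-(x (.inr (.inr (.inr j))) / lam j) * Real.cos (lam j * t)
          + x (.inr (.inr (.inl j))) / lam j * Real.sin (lam j * t)
          + x (.inr (.inl (.inr j)))) • B' j
        + ∑ k, (x (.inl (.inr (.inl k))) + x (.inl (.inr (.inr k))) * t) • C k := by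
  simp only [Finset.sum_apply, Pi.smul_apply, Fintype.sum_sum_type, solutionFamily, Sum.elim_inl,
    Sum.elim_inr, add_smul, Finset.sum_add_distrib, smul_add, smul_sub, Finset.sum_sub_distrib,
    smul_smul, neg_mul, neg_smul, Finset.sum_neg_distrib, div_eq_mul_inv, one_mul, mul_assoc]
  abel

lemma eq_zero_of_sum_smul_eq_zero
    (he : LinearIndependent ℝ (Sum.elim (Sum.elim A C) (Sum.elim B B')))
    {a : Fin r → ℝ} {b c : Fin M → ℝ} {d : Fin s → ℝ}
    (h : ∑ i, a i • A i + ∑ j, b j • B j + ∑ j, c j • B' j + ∑ k, d k • C k = 0) :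
    (∀ i, a i = 0) ∧ (∀ k, d k = 0) ∧ (∀ j, b j = 0) ∧ (∀ j, c j = 0) := by
  have := Fintype.linearIndependent_iff.1 he (Sum.elim (Sum.elim a d) (Sum.elim b c)) (by
    rw [← h]
    simp only [Fintype.sum_sum_type, Sum.elim_inl, Sum.elim_inr]
    abel)
  simpa only [Sum.forall, Sum.elim_inl, Sum.elim_inr, and_assoc] using this

theorem linearIndependent_solutionFamily
    (he : LinearIndependent ℝ (Sum.elim (Sum.elim A C) (Sum.elim B B')))
    (hlam : ∀ j, lam j ≠ 0) : LinearIndependent ℝ (solutionFamily A C B B' lam) := by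
  rw [Fintype.linearIndependent_iff]
  intro x hx
  have key (t : ℝ) :
      (∀ i, x (.inl (.inl (.inl i))) + x (.inl (.inl (.inr i))) * t = 0) ∧
      (∀ k, x (.inl (.inr (.inl k))) + x (.inl (.inr (.inr k))) * t = 0) ∧
      (∀ j, x (.inr (.inr (.inl j))) * Real.cos (lam j * t)
          + x (.inr (.inr (.inr j))) * Real.sin (lam j * t) + x (.inr (.inl (.inl j))) = 0) ∧
      (∀ j, -(x (.inr (.inr (.inr j))) / lam j) * Real.cos (lam j * t)
          + x (.inr (.inr (.inl j))) / lam j * Real.sin (lam j * t)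
          + x (.inr (.inl (.inr j))) = 0) := by
    have h := congrFun hx t
    rw [sum_smul_solutionFamily] at h
    exact eq_zero_of_sum_smul_eq_zero he h
  have affine {p q : ℝ} (h : ∀ t, p + q * t = 0) : p = 0 ∧ q = 0 := by
    have h₀ := h 0
    have h₁ := h 1
    constructor <;> linarith
  -- At `t = 0` and `t = π/λ` the sine vanishes and the cosine is `±1`, so `κ + α = 0` and `κ - α =
  -- 0`.
  have hα (j) : x (.inr (.inr (.inl j))) = 0 ∧ x (.inr (.inl (.inl j))) = 0 := by
    have h₀ := (key 0).2.2.1 j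
    have h₁ := (key (Real.pi / lam j)).2.2.1 j
    rw [mul_div_cancel₀ _ (hlam j), Real.cos_pi, Real.sin_pi] at h₁
    simp only [mul_zero, Real.cos_zero, Real.sin_zero] at h₀
    constructor <;> linarith
  -- At `t = π/(2λ)` the cosine vanishes and, `κ` being zero, only `β` remains.
  have hβ (j) : x (.inr (.inr (.inr j))) = 0 := by
    have h₁ := (key (Real.pi / 2 / lam j)).2.2.1 j
    rw [mul_div_cancel₀ _ (hlam j), Real.cos_pi_div_two, Real.sin_pi_div_two, (hα j).2] at h₁
    linarith
  rintro (((i | i) | (i | i)) | ((j | j) | (j | j)))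
  · exact (affine fun t ↦ (key t).1 i).1
  · exact (affine fun t ↦ (key t).1 i).2
  · exact (affine fun t ↦ (key t).2.1 i).1
  · exact (affine fun t ↦ (key t).2.1 i).2
  · exact (hα j).2
  · simpa [hα j, hβ j] using (key 0).2.2.2 j
  · exact (hα j).1
  · exact hβ j

theorem span_solutionFamily [FiniteDimensional ℝ V]
    (he : LinearIndependent ℝ (Sum.elim (Sum.elim A C) (Sum.elim B B')))
    (htop : Submodule.span ℝ (Set.range (Sum.elim (Sum.elim A C) (Sum.elim B B'))) = ⊤)
    (hlam : ∀ j, lam j ≠ 0) {L : V →ₗ[ℝ] V} (hA : ∀ i, L (A i) = 0) (hC : ∀ i, L (C i) = 0)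
    (hB : ∀ j, L (B j) = (-(1 / 2) : ℝ) • B' j)
    (hB' : ∀ j, L (B' j) = ((1 / 2 : ℝ) * lam j ^ 2) • B j) (y : ℝ → V) :
    y ∈ Submodule.span ℝ (Set.range (solutionFamily A C B B' lam)) ↔
      ContDiff ℝ ∞ y ∧ ∀ t, deriv (deriv y) t + (2 : ℝ) • L (deriv y t) = 0 := by
  rw [Submodule.mem_span_range_iff_exists_fun]
  constructor
  · rintro ⟨x, rfl⟩
    refine (deriv_deriv_add_two_smul_eq_zero_iff he hlam hA hC hB hB' _ _ _ _
      (funext (sum_smul_solutionFamily x))).2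
      ⟨fun i ↦ ⟨_, _, fun t ↦ rfl⟩, fun i ↦ ⟨_, _, fun t ↦ rfl⟩,
        fun j ↦ ⟨_, _, _, _, fun t ↦ ⟨rfl, rfl⟩⟩⟩
  · intro h
    -- Since the frame spans, an arbitrary solution has coordinate functions; their regularity comes
    -- from that of `y`.
    have hc (t : ℝ) := (Submodule.mem_span_range_iff_exists_fun ℝ).1
      (htop ▸ Submodule.mem_top : y t ∈ _)
    choose f hf using hc
    have hy : y = fun t ↦ ∑ i, f t (.inl (.inl i)) • A i + ∑ j, f t (.inr (.inl j)) • B j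
        + ∑ j, f t (.inr (.inr j)) • B' j + ∑ k, f t (.inl (.inr k)) • C k := by
      ext t
      rw [← hf t]
      simp only [Fintype.sum_sum_type, Sum.elim_inl, Sum.elim_inr]
      abel
    obtain ⟨ha, hd, hbc⟩ := (deriv_deriv_add_two_smul_eq_zero_iff he hlam hA hC hB hB'
      (fun i t ↦ f t (.inl (.inl i))) (fun j t ↦ f t (.inr (.inl j)))
      (fun j t ↦ f t (.inr (.inr j))) (fun k t ↦ f t (.inl (.inr k))) hy).1 h
    choose p q ha using ha
    choose p' q' hd using hd
    choose α β κ δ hbc using hbc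
    refine ⟨Sum.elim (Sum.elim (Sum.elim p q) (Sum.elim p' q'))
      (Sum.elim (Sum.elim κ δ) (Sum.elim α β)), ?_⟩
    ext t
    rw [sum_smul_solutionFamily, hy]
    simp only [ha, hd, (hbc _ t).1, (hbc _ t).2, Sum.elim_inl, Sum.elim_inr]

end VectorODE

/-! ### The operator `∇_Z` for central `Z`, and the Jacobi equation -/

section TwoStep

variable {E : Type*} [NormedAddCommGroup E] [NormedSpace ℝ E] [FiniteDimensional ℝ E]
  {N : Type*} [TopologicalSpace N] [ChartedSpace E N] [Group N] [LieGroup 𝓘(ℝ, E) ∞ N]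
  {g : ContMDiffRiemannianMetric 𝓘(ℝ, E) ∞ E (TangentSpace 𝓘(ℝ, E) : N → Type _)}
  {D : CovariantDerivative 𝓘(ℝ, E) E (TangentSpace 𝓘(ℝ, E) : N → Type _)}
  {Z : GroupLieAlgebra 𝓘(ℝ, E) N}

lemma mem_lieCenter_iff {X : GroupLieAlgebra 𝓘(ℝ, E) N} :
    X ∈ lieCenter E N ↔ ∀ Y : GroupLieAlgebra 𝓘(ℝ, E) N, ⁅Y, X⁆ = 0 :=
  Iff.rfl

lemma lie_eq_zero_of_mem_lieCenter {X : GroupLieAlgebra 𝓘(ℝ, E) N} (hX : X ∈ lieCenter E N)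
    (Y : GroupLieAlgebra 𝓘(ℝ, E) N) : ⁅X, Y⁆ = 0 := by
  rw [← lie_skew, mem_lieCenter_iff.1 hX Y, neg_zero]

lemma IsTwoStepNilpotent.lieCommutator_le_lieCenter (hN : IsTwoStepNilpotent E N) :
    lieCommutator E N ≤ lieCenter E N := by
  have : ⁅(⊤ : LieIdeal ℝ (GroupLieAlgebra 𝓘(ℝ, E) N)),
      (⊤ : LieIdeal ℝ (GroupLieAlgebra 𝓘(ℝ, E) N))⁆
      ≤ LieAlgebra.center ℝ (GroupLieAlgebra 𝓘(ℝ, E) N) := by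
    rw [LieSubmodule.lie_le_iff]
    intro X _ Y _ W
    rw [← lie_skew, hN.lie_lie_eq_zero, neg_zero]
  exact this

lemma lieInner_eq_zero_of_mem_lieCenter {X : GroupLieAlgebra 𝓘(ℝ, E) N} (hX : X ∈ lieCenter E N)
    (Y : lieV g) : lieInner g Y X = 0 := by
  rw [lieInner_symm]
  exact LinearMap.BilinForm.mem_orthogonal_iff.1 Y.2 X hX

/-- Positive definiteness keeps the form nondegenerate on the center, so the center and `𝔳` are
complementary. -/
lemma exists_add_mem_lieCenter (g : ContMDiffRiemannianMetric 𝓘(ℝ, E) ∞ E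
    (TangentSpace 𝓘(ℝ, E) : N → Type _)) (W : GroupLieAlgebra 𝓘(ℝ, E) N) :
    ∃ U ∈ lieCenter E N, ∃ V : lieV g, U + V = W := by
  have hrefl : (lieInner g).IsRefl := fun X Y h ↦ by rwa [lieInner_symm]
  have : FiniteDimensional ℝ (GroupLieAlgebra 𝓘(ℝ, E) N) := ‹FiniteDimensional ℝ E›
  have h := LinearMap.BilinForm.isCompl_orthogonal_of_restrict_nondegenerate hrefl
    (lieInner_restrict_nondegenerate g (lieCenter E N))
  obtain ⟨U, hU, V, hV, h⟩ := Submodule.mem_sup.1 (h.sup_eq_top ▸ Submodule.mem_top : W ∈ _)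
  exact ⟨U, hU, ⟨V, hV⟩, h⟩

/-- All three brackets in the Koszul formula vanish. -/
lemma IsLeviCivita.lieConnection_of_mem_lieCenter (hD : IsLeviCivita g D) (hg : IsLeftInvariant g)
    (hZ : Z ∈ lieCenter E N) {X : GroupLieAlgebra 𝓘(ℝ, E) N} (hX : X ∈ lieCenter E N) :
    lieConnection D Z X = 0 := by
  refine eq_of_lieInner_eq (g := g) fun W ↦ ?_
  have h := hD.two_mul_lieInner_lieConnection hg Z X W
  rw [lie_eq_zero_of_mem_lieCenter hZ, lie_eq_zero_of_mem_lieCenter hX,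
    mem_lieCenter_iff.1 hZ] at h
  simpa using h

/-- With `Z` central, Koszul reduces to `2⟨∇_Z X, W⟩ = -⟨[X, W], Z⟩`. -/
lemma IsLeviCivita.lieConnection_lieV (hD : IsLeviCivita g D) (hg : IsLeftInvariant g)
    (hZ : Z ∈ lieCenter E N) (X : lieV g) :
    lieConnection D Z X = (-(1 / 2) : ℝ) • (jMap g Z X).1 := by
  refine eq_of_lieInner_eq (g := g) fun W ↦ ?_
  have h := hD.two_mul_lieInner_lieConnection hg Z X W
  rw [lie_eq_zero_of_mem_lieCenter hZ, mem_lieCenter_iff.1 hZ] at h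
  obtain ⟨U, hU, V, rfl⟩ := exists_add_mem_lieCenter g W
  -- The defining property of `j(Z)` tests only against `𝔳`. It extends to all of `𝔫` because a
  -- central `U` is orthogonal to `j(Z)X` and commutes with `X`.
  have h₁ : lieInner g (jMap g Z X).1 (U + V) = lieInner g ⁅X.1, U + V.1⁆ Z := by
    rw [lie_add, mem_lieCenter_iff.1 hU, zero_add, map_add, lieInner_jMap,
      lieInner_eq_zero_of_mem_lieCenter hU, zero_add]
  rw [map_smul, LinearMap.smul_apply, h₁, smul_eq_mul]
  simp only [map_zero, LinearMap.zero_apply] at h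
  linarith

lemma IsLeviCivita.lieConnection_comm (hD : IsLeviCivita g D) (hg : IsLeftInvariant g)
    (hZ : Z ∈ lieCenter E N) (X : GroupLieAlgebra 𝓘(ℝ, E) N) :
    lieConnection D X Z = lieConnection D Z X := by
  refine eq_of_lieInner_eq (g := g) fun W ↦ ?_
  have h₁ := hD.two_mul_lieInner_lieConnection hg Z X W
  have h₂ := hD.two_mul_lieInner_lieConnection hg X Z W
  rw [lie_eq_zero_of_mem_lieCenter hZ, mem_lieCenter_iff.1 hZ] at h₁ h₂
  rw [← lie_skew] at h₂
  simp only [map_zero, map_neg, LinearMap.neg_apply, LinearMap.zero_apply] at h₁ h₂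
  linarith

/-- Of the three curvature terms, `∇_X ∇_Z Z` vanishes since `∇_Z Z = 0`, and `∇_[X,Z] Z` since `[X,
Z] = 0`. In the middle one, `∇_X Z = ∇_Z X`. -/
lemma IsLeviCivita.curvatureAt_central (hD : IsLeviCivita g D) (hg : IsLeftInvariant g)
    (hZ : Z ∈ lieCenter E N) (X : GroupLieAlgebra 𝓘(ℝ, E) N) (x : N) :
    curvatureAt D x (mulInvariantVectorField X x) (mulInvariantVectorField Z x)
        (mulInvariantVectorField Z x)
      = mulInvariantVectorField (-lieConnection D Z (lieConnection D Z X)) x := by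
  have h₀ : lieConnection D 0 Z = 0 := map_zero (D (mulInvariantVectorField Z) 1)
  rw [hD.curvatureAt_mulInvariantVectorField hg, hD.lieConnection_of_mem_lieCenter hg hZ hZ,
    hD.lieConnection_comm hg hZ, mem_lieCenter_iff.1 hZ, h₀]
  simp

lemma IsLeviCivita.curvatureAt_one_lieV (hD : IsLeviCivita g D) (hg : IsLeftInvariant g)
    (hZ : Z ∈ lieCenter E N) (X : lieV g) :
    curvatureAt D (1 : N) X.1 Z Z = (-(1 / 4) : ℝ) • (jMap g Z (jMap g Z X)).1 := by
  have h := hD.curvatureAt_central hg hZ X.1 1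
  simp only [mulInvariantVectorField_one] at h
  rw [h, hD.lieConnection_lieV hg hZ, map_smul, hD.lieConnection_lieV hg hZ, smul_smul, ← neg_smul]
  norm_num

lemma IsExpCurve.covDerivAlong_of_hasDerivAt (hD : IsLeviCivita g D) (hg : IsLeftInvariant g)
    {γ : ℝ → N} (hγ : IsExpCurve Z γ) {L : E →ₗ[ℝ] E} (hL : L = lieConnection D Z)
    {y : ℝ → E} {y' : E} {t : ℝ} (hy : HasDerivAt y y' t) :
    covDerivAlong D γ (fun t ↦ mulInvariantVectorField (I := 𝓘(ℝ, E)) (y t) (γ t)) t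
      = mulInvariantVectorField (I := 𝓘(ℝ, E)) (y' + L (y t)) (γ t) := by
  rw [← hy.deriv, hL]
  exact hγ.covDerivAlong_eq hD hg y t

/-- Two covariant derivatives give `y'' + 2Ly' + L²y`, and the curvature term `-L²y` cancels the
zeroth-order part. -/
lemma IsExpCurve.isJacobiField_iff (hD : IsLeviCivita g D) (hg : IsLeftInvariant g)
    (hZ : Z ∈ lieCenter E N) {γ : ℝ → N} (hγ : IsExpCurve Z γ) {L : E →ₗ[ℝ] E}
    (hL : L = lieConnection D Z) (y : ℝ → E) :
    IsJacobiField D γ (fun t ↦ mulInvariantVectorField (I := 𝓘(ℝ, E)) (y t) (γ t)) ↔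
      ContDiff ℝ ∞ y ∧ ∀ t, deriv (deriv y) t + (2 : ℝ) • L (deriv y t) = 0 := by
  have hs := contMDiff_mulInvariantVectorField_along_iff hγ.smooth y
  have key (hy : ContDiff ℝ ∞ y) (t : ℝ) :
      covDerivAlong D γ (covDerivAlong D γ
          fun t ↦ mulInvariantVectorField (I := 𝓘(ℝ, E)) (y t) (γ t)) t
        + curvatureAt D (γ t) (mulInvariantVectorField (I := 𝓘(ℝ, E)) (y t) (γ t))
            (velocity γ t) (velocity γ t)
      = mulInvariantVectorField (I := 𝓘(ℝ, E))
          (deriv (deriv y) t + (2 : ℝ) • L (deriv y t)) (γ t) := by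
    have h₁ : covDerivAlong D γ (fun t ↦ mulInvariantVectorField (I := 𝓘(ℝ, E)) (y t) (γ t))
        = fun t ↦ mulInvariantVectorField (I := 𝓘(ℝ, E)) (deriv y t + L (y t)) (γ t) := by
      ext t
      rw [hγ.covDerivAlong_of_hasDerivAt hD hg hL (hy.differentiable (by simp) t).hasDerivAt]
    have hd : DifferentiableAt ℝ (fun t ↦ deriv y t + L (y t)) t :=
      ((contDiff_infty_iff_deriv.1 hy).2.differentiable (by simp) t).add
        (L.toContinuousLinearMap.differentiableAt.comp t (hy.differentiable (by simp) t))
    have hc : curvatureAt D (γ t) (mulInvariantVectorField (I := 𝓘(ℝ, E)) (y t) (γ t))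
        (mulInvariantVectorField Z (γ t)) (mulInvariantVectorField Z (γ t))
        = mulInvariantVectorField (I := 𝓘(ℝ, E)) (-L (L (y t))) (γ t) := by
      subst hL
      exact hD.curvatureAt_central hg hZ (y t) (γ t)
    rw [h₁, hγ.covDerivAlong_of_hasDerivAt hD hg hL hd.hasDerivAt, hγ.velocity_eq,
      deriv_deriv_add_linearMap L hy]
    refine (congrArg (_ + ·) hc).trans ?_
    refine ((mulInvariantEquiv (E := E) (γ t)).map_add _ _).symm.trans
      (congrArg (mulInvariantEquiv (γ t)) ?_)
    change (deriv (deriv y) t + L (deriv y t) + L (deriv y t + L (y t)) + -L (L (y t)) : E) = _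
    rw [map_add, two_smul]
    abel
  have hzero (v : E) (t : ℝ) : mulInvariantVectorField (I := 𝓘(ℝ, E)) v (γ t) = 0 ↔ v = 0 :=
    (mulInvariantEquiv (E := E) (γ t)).map_eq_zero_iff
  constructor
  · rintro ⟨h₁, h₂⟩
    have hy := hs.1 h₁
    exact ⟨hy, fun t ↦ (hzero _ t).1 ((key hy t).symm.trans (h₂ t))⟩
  · rintro ⟨hy, h⟩
    exact ⟨hs.2 hy, fun t ↦ (key hy t).trans ((hzero _ t).2 (h t))⟩

end TwoStep

/-! ### Adapted bases and explicit fields along `γ` -/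

section AdaptedBasis

variable {E : Type*} [NormedAddCommGroup E] [NormedSpace ℝ E] [FiniteDimensional ℝ E]
  {N : Type*} [TopologicalSpace N] [ChartedSpace E N] [Group N] [LieGroup 𝓘(ℝ, E) ∞ N]
  {g : ContMDiffRiemannianMetric 𝓘(ℝ, E) ∞ E (TangentSpace 𝓘(ℝ, E) : N → Type _)}
  {D : CovariantDerivative 𝓘(ℝ, E) E (TangentSpace 𝓘(ℝ, E) : N → Type _)}
  {Z : GroupLieAlgebra 𝓘(ℝ, E) N} {r M s : ℕ} {A : Fin r → lieV g} {B : Fin M → lieV g}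
  {C : Fin s → GroupLieAlgebra 𝓘(ℝ, E) N} {lam : Fin M → ℝ}

lemma IsAdaptedBasis.lieConnection_A (hb : IsAdaptedBasis g D Z A B C lam)
    (hD : IsLeviCivita g D) (hg : IsLeftInvariant g) (hZ : Z ∈ lieCenter E N) (i : Fin r) :
    lieConnection D Z (A i).1 = 0 := by
  have : A i ∈ LinearMap.ker (jMap g Z) := hb.span_A ▸ Submodule.subset_span ⟨i, rfl⟩
  rw [hD.lieConnection_lieV hg hZ, LinearMap.mem_ker.1 this]
  simp

lemma IsAdaptedBasis.lieConnection_C (hb : IsAdaptedBasis g D Z A B C lam)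
    (hD : IsLeviCivita g D) (hg : IsLeftInvariant g) (hZ : Z ∈ lieCenter E N) (k : Fin s) :
    lieConnection D Z (C k) = 0 :=
  hD.lieConnection_of_mem_lieCenter hg hZ (hb.span_C ▸ Submodule.subset_span ⟨k, rfl⟩)

/-- The eigenvalue condition amounts to `j(Z)²B = -λ²B`, because `R_Z = -¼ j(Z)²` on `𝔳`. -/
lemma IsAdaptedBasis.lieConnection_jMap_B (hb : IsAdaptedBasis g D Z A B C lam)
    (hD : IsLeviCivita g D) (hg : IsLeftInvariant g) (hZ : Z ∈ lieCenter E N) (j : Fin M) :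
    lieConnection D Z (jMap g Z (B j)).1 = ((1 / 2 : ℝ) * lam j ^ 2) • (B j).1 := by
  have h := hb.curvature_B j
  rw [hD.curvatureAt_one_lieV hg hZ] at h
  rw [hD.lieConnection_lieV hg hZ]
  calc (-(1 / 2) : ℝ) • (jMap g Z (jMap g Z (B j))).1
      = (2 : ℝ) • ((-(1 / 4) : ℝ) • (jMap g Z (jMap g Z (B j))).1) := by
        rw [smul_smul]; norm_num
    _ = ((1 / 2 : ℝ) * lam j ^ 2) • (B j).1 := by
        rw [h, smul_smul]; congr 1; ring

/-- Vector fields along `γ`, in the left-invariant trivialization. -/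
def alongEquiv (γ : ℝ → N) : (ℝ → E) ≃ₗ[ℝ] Π t : ℝ, TangentSpace 𝓘(ℝ, E) (γ t) :=
  LinearEquiv.piCongrRight fun t ↦ mulInvariantEquiv (E := E) (γ t)

lemma alongCurve_add (γ : ℝ → N) (X Y : GroupLieAlgebra 𝓘(ℝ, E) N) (t : ℝ) :
    alongCurve γ (X + Y) t = alongCurve γ X t + alongCurve γ Y t :=
  (mulInvariantEquiv (E := E) (γ t)).map_add X Y

lemma alongCurve_sub (γ : ℝ → N) (X Y : GroupLieAlgebra 𝓘(ℝ, E) N) (t : ℝ) :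
    alongCurve γ (X - Y) t = alongCurve γ X t - alongCurve γ Y t :=
  (mulInvariantEquiv (E := E) (γ t)).map_sub X Y

lemma alongCurve_smul (γ : ℝ → N) (c : ℝ) (X : GroupLieAlgebra 𝓘(ℝ, E) N) (t : ℝ) :
    alongCurve γ (c • X) t = c • alongCurve γ X t :=
  (mulInvariantEquiv (E := E) (γ t)).map_smul c X

lemma alongCurve_sum (γ : ℝ → N) {ι : Type*} [Fintype ι] (c : ι → ℝ)
    (X : ι → GroupLieAlgebra 𝓘(ℝ, E) N) (t : ℝ) :
    alongCurve γ (∑ i, c i • X i) t = ∑ i, c i • alongCurve γ (X i) t := by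
  refine (map_sum (mulInvariantEquiv (E := E) (γ t)) _ _).trans ?_
  exact Finset.sum_congr rfl fun i _ ↦ alongCurve_smul γ _ _ t

/-- The covariant derivative along `γ` of a combination of two left-invariant fields. -/
lemma IsExpCurve.covDerivAlong_smul_add_smul (hD : IsLeviCivita g D) (hg : IsLeftInvariant g)
    {γ : ℝ → N} (hγ : IsExpCurve Z γ) {f f₂ : ℝ → ℝ} {f' f₂' t : ℝ} (hf : HasDerivAt f f' t)
    (hf₂ : HasDerivAt f₂ f₂' t) (X X₂ : GroupLieAlgebra 𝓘(ℝ, E) N) :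
    covDerivAlong D γ (fun t ↦ f t • alongCurve γ X t + f₂ t • alongCurve γ X₂ t) t
      = f' • alongCurve γ X t + f₂' • alongCurve γ X₂ t
        + f t • alongCurve γ (lieConnection D Z X) t
        + f₂ t • alongCurve γ (lieConnection D Z X₂) t := by
  have hy : HasDerivAt (F := E) (fun t ↦ f t • (X : E) + f₂ t • (X₂ : E))
      (f' • (X : E) + f₂' • (X₂ : E)) t := 
    (hf.smul_const (F := E) X).add (hf₂.smul_const (F := E) X₂)
  have h := hγ.covDerivAlong_of_hasDerivAt hD hg rfl hy
  have h₁ : (fun t ↦ f t • alongCurve γ X t + f₂ t • alongCurve γ X₂ t)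
      = fun t ↦ alongCurve γ (f t • X + f₂ t • X₂) t := by
    ext t; rw [alongCurve_add, alongCurve_smul, alongCurve_smul]
  rw [h₁]
  refine h.trans ?_
  change alongCurve γ (f' • X + f₂' • X₂ + lieConnection D Z (f t • X + f₂ t • X₂)) t = _
  rw [map_add, map_smul, map_smul]
  simp only [alongCurve_add, alongCurve_smul, add_assoc]

lemma IsExpCurve.covDerivAlong_smul (hD : IsLeviCivita g D) (hg : IsLeftInvariant g)
    {γ : ℝ → N} (hγ : IsExpCurve Z γ) {f : ℝ → ℝ} {f' t : ℝ} (hf : HasDerivAt f f' t)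
    (X : GroupLieAlgebra 𝓘(ℝ, E) N) :
    covDerivAlong D γ (fun t ↦ f t • alongCurve γ X t) t
      = f' • alongCurve γ X t + f t • alongCurve γ (lieConnection D Z X) t := by
  simpa using hγ.covDerivAlong_smul_add_smul hD hg hf (hasDerivAt_const t 0) X X

lemma IsExpCurve.covDerivAlong_alongCurve (hD : IsLeviCivita g D) (hg : IsLeftInvariant g)
    {γ : ℝ → N} (hγ : IsExpCurve Z γ) (X : GroupLieAlgebra 𝓘(ℝ, E) N) (t : ℝ) :
    covDerivAlong D γ (alongCurve γ X) t = alongCurve γ (lieConnection D Z X) t := by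
  simpa using hγ.covDerivAlong_smul hD hg (hasDerivAt_const t 1) X

lemma alongCurve_zero (γ : ℝ → N) (t : ℝ) :
    alongCurve γ (0 : GroupLieAlgebra 𝓘(ℝ, E) N) t = 0 :=
  (mulInvariantEquiv (E := E) (γ t)).map_zero

/-- Transports independence and span from curves in the fixed space `E` to fields along `γ`. -/
lemma jacobiFamily_eq (Z : GroupLieAlgebra 𝓘(ℝ, E) N) (γ : ℝ → N) (A : Fin r → lieV g)
    (B : Fin M → lieV g) (C : Fin s → GroupLieAlgebra 𝓘(ℝ, E) N) (lam : Fin M → ℝ) :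
    jacobiFamily g Z γ A B C lam = alongEquiv γ ∘ solutionFamily (V := E) (fun i ↦ (A i).1) C
      (fun j ↦ (B j).1) (fun j ↦ (jMap g Z (B j)).1) lam := by
  ext i t
  rcases i with (((i | i) | (i | i)) | ((i | i) | (i | i)))
  · rfl
  · exact (alongCurve_smul γ t _ t).symm
  · rfl
  · exact (alongCurve_smul γ t _ t).symm
  · rfl
  · rfl
  · change _ = alongCurve γ (Real.cos (lam i * t) • (B i).1
      + (1 / lam i * Real.sin (lam i * t)) • (jMap g Z (B i)).1) t
    rw [alongCurve_add, alongCurve_smul, alongCurve_smul]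
    rfl
  · change _ = alongCurve γ (Real.sin (lam i * t) • (B i).1
      - (1 / lam i * Real.cos (lam i * t)) • (jMap g Z (B i)).1) t
    rw [alongCurve_sub, alongCurve_smul, alongCurve_smul]
    rfl

end AdaptedBasis

end

/-! ### The main theorem -/

theorem proposition3p1
    {E : Type*} [NormedAddCommGroup E] [NormedSpace ℝ E] [FiniteDimensional ℝ E]
    {N : Type*} [TopologicalSpace N] [ChartedSpace E N] [Group N] [LieGroup 𝓘(ℝ, E) ∞ N]
    [SimplyConnectedSpace N] (hN : IsTwoStepNilpotent E N)
    (g : ContMDiffRiemannianMetric 𝓘(ℝ, E) ∞ E (TangentSpace 𝓘(ℝ, E) : N → Type _))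
    (hg : IsLeftInvariant g)
    (D : CovariantDerivative 𝓘(ℝ, E) E (TangentSpace 𝓘(ℝ, E) : N → Type _))
    (hD : IsLeviCivita g D)
    (Z : GroupLieAlgebra 𝓘(ℝ, E) N) (hZ : Z ∈ lieCommutator E N)
    (γ : ℝ → N) (hγ : IsExpCurve Z γ)
    {r M s : ℕ} (A : Fin r → lieV g) (B : Fin M → lieV g)
    (C : Fin s → GroupLieAlgebra 𝓘(ℝ, E) N) (lam : Fin M → ℝ)
    (hbasis : IsAdaptedBasis g D Z A B C lam) :
    -- the curvature operator `R_Z` on `𝔳`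
    (∀ X : lieV g, curvatureAt D (1 : N) X.1 Z Z = (-(1 / 4) : ℝ) • (jMap g Z (jMap g Z X)).1) ∧
    -- the solution of the Jacobi equation
    (∀ (a : Fin r → ℝ → ℝ) (b c : Fin M → ℝ → ℝ) (d : Fin s → ℝ → ℝ),
      IsJacobiField D γ (fun t ↦
          ∑ i, a i t • alongCurve γ (A i).1 t + ∑ j, b j t • alongCurve γ (B j).1 t
          + ∑ j, c j t • alongCurve γ (jMap g Z (B j)).1 t + ∑ α, d α t • alongCurve γ (C α) t) ↔
        (∀ i, ∃ p q : ℝ, ∀ t, a i t = p + q * t) ∧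
        (∀ α, ∃ p q : ℝ, ∀ t, d α t = p + q * t) ∧
        (∀ j, ∃ α β κ δ : ℝ, ∀ t,
          b j t = α * Real.cos (lam j * t) + β * Real.sin (lam j * t) + κ ∧
          c j t = -(β / lam j) * Real.cos (lam j * t) + α / lam j * Real.sin (lam j * t) + δ)) ∧
    -- the listed fields form a basis of the space of Jacobi fields
    (LinearIndependent ℝ (jacobiFamily g Z γ A B C lam) ∧
      (Submodule.span ℝ (Set.range (jacobiFamily g Z γ A B C lam)) :
        Set (Π t : ℝ, TangentSpace 𝓘(ℝ, E) (γ t))) = {Y | IsJacobiField D γ Y}) ∧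
    -- their covariant derivatives
    (∀ i t, covDerivAlong D γ (alongCurve γ (A i).1) t = 0) ∧
    (∀ i t, covDerivAlong D γ (fun u ↦ u • alongCurve γ (A i).1 u) t
      = alongCurve γ (A i).1 t) ∧
    (∀ α t, covDerivAlong D γ (alongCurve γ (C α)) t = 0) ∧
    (∀ α t, covDerivAlong D γ (fun u ↦ u • alongCurve γ (C α) u) t = alongCurve γ (C α) t) ∧
    (∀ j t, covDerivAlong D γ (alongCurve γ (B j).1) t
      = (-(1 / 2) : ℝ) • alongCurve γ (jMap g Z (B j)).1 t) ∧
    (∀ j t, covDerivAlong D γ (alongCurve γ (jMap g Z (B j)).1) t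
      = ((1 / 2 : ℝ) * lam j ^ 2) • alongCurve γ (B j).1 t) ∧
    (∀ j t, covDerivAlong D γ (fieldX g Z γ (B j) (lam j)) t
      = (-(1 / 2) * lam j : ℝ) • fieldY g Z γ (B j) (lam j) t) ∧
    (∀ j t, covDerivAlong D γ (fieldY g Z γ (B j) (lam j)) t
      = ((1 / 2 : ℝ) * lam j) • fieldX g Z γ (B j) (lam j) t) := by
  have hZ' : Z ∈ lieCenter E N := hN.lieCommutator_le_lieCenter hZ
  have hl (j) : lam j ≠ 0 := (hbasis.lam_pos j).ne'
  let L : E →ₗ[ℝ] E := lieConnection D Z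
  have hA (i) : lieConnection D Z (A i).1 = 0 := hbasis.lieConnection_A hD hg hZ' i
  have hC (k) : lieConnection D Z (C k) = 0 := hbasis.lieConnection_C hD hg hZ' k
  have hB (j) : lieConnection D Z (B j).1 = (-(1 / 2) : ℝ) • (jMap g Z (B j)).1 :=
    hD.lieConnection_lieV hg hZ' (B j)
  have hB' (j) : lieConnection D Z (jMap g Z (B j)).1 = ((1 / 2 : ℝ) * lam j ^ 2) • (B j).1 :=
    hbasis.lieConnection_jMap_B hD hg hZ' j
  have hjac (y : ℝ → E) : IsJacobiField D γ (alongEquiv γ y) ↔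
      ContDiff ℝ ∞ y ∧ ∀ t, deriv (deriv y) t + (2 : ℝ) • L (deriv y t) = 0 :=
    hγ.isJacobiField_iff hD hg hZ' rfl y
  refine ⟨hD.curvatureAt_one_lieV hg hZ', fun a b c d ↦ ?_, ⟨?_, ?_⟩, fun i t ↦ ?_, fun i t ↦ ?_,
    fun k t ↦ ?_, fun k t ↦ ?_, fun j t ↦ ?_, fun j t ↦ ?_, fun j t ↦ ?_, fun j t ↦ ?_⟩
  · rw [← deriv_deriv_add_two_smul_eq_zero_iff (V := E) (L := L) hbasis.linearIndependent hl
      hA hC hB hB' a b c d rfl, ← hjac]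
    refine iff_of_eq (congrArg _ (funext fun t ↦ ?_))
    change _ = alongCurve γ (∑ i, a i t • (A i).1 + ∑ j, b j t • (B j).1
      + ∑ j, c j t • (jMap g Z (B j)).1 + ∑ k, d k t • C k) t
    rw [alongCurve_add, alongCurve_add, alongCurve_add, alongCurve_sum, alongCurve_sum,
      alongCurve_sum, alongCurve_sum]
  · rw [jacobiFamily_eq]
    exact (linearIndependent_solutionFamily (V := E) hbasis.linearIndependent hl).map'
      (alongEquiv γ).toLinearMap (alongEquiv γ).ker
  · ext Y
    obtain ⟨y, rfl⟩ := (alongEquiv γ).surjective Y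
    rw [Set.mem_ofPred_eq, hjac, ← span_solutionFamily (V := E) (L := L) hbasis.linearIndependent
      hbasis.span_eq_top hl hA hC hB hB', jacobiFamily_eq, Set.range_comp,
      SetLike.mem_coe]
    refine Iff.trans (b := alongEquiv γ y ∈ Submodule.map (alongEquiv γ).toLinearMap _)
      (by rw [Submodule.map_span]; rfl) ?_
    exact (alongEquiv γ).injective.mem_set_image
  · rw [hγ.covDerivAlong_alongCurve hD hg, hA, alongCurve_zero]
  · rw [hγ.covDerivAlong_smul hD hg (hasDerivAt_id' t), hA, alongCurve_zero]
    simp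
  · rw [hγ.covDerivAlong_alongCurve hD hg, hC, alongCurve_zero]
  · rw [hγ.covDerivAlong_smul hD hg (hasDerivAt_id' t), hC, alongCurve_zero]
    simp
  · rw [hγ.covDerivAlong_alongCurve hD hg, hB, alongCurve_smul]
  · rw [hγ.covDerivAlong_alongCurve hD hg, hB', alongCurve_smul]
  · have hlt : HasDerivAt (fun t ↦ lam j * t) (lam j) t := by
      simpa using (hasDerivAt_id t).const_mul (lam j)
    refine (hγ.covDerivAlong_smul_add_smul hD hg hlt.cos (hlt.sin.const_mul (1 / lam j))
      _ _).trans ?_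
    rw [hB, hB', alongCurve_smul, alongCurve_smul, fieldY]
    match_scalars
    · field_simp [hl j]; ring
    · field_simp [hl j]; ring
  · have hlt : HasDerivAt (fun t ↦ lam j * t) (lam j) t := by
      simpa using (hasDerivAt_id t).const_mul (lam j)
    have h : fieldY g Z γ (B j) (lam j) = fun t ↦ Real.sin (lam j * t) • alongCurve γ (B j).1 t
        + (-(1 / lam j) * Real.cos (lam j * t)) • alongCurve γ (jMap g Z (B j)).1 t := by
      ext t
      rw [fieldY, neg_mul, neg_smul, sub_eq_add_neg]
    rw [h, hγ.covDerivAlong_smul_add_smul hD hg hlt.sin (hlt.cos.const_mul (-(1 / lam j))),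
      hB, hB', alongCurve_smul, alongCurve_smul, fieldX]
    match_scalars
    · field_simp [hl j]; ring
    · field_simp [hl j]; ring
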